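/- For every integer $n\ge 1$ there is a constant $\delta_0=\delta_0(n)>0$ with the following property. Let $F\subset S^{n-1}$ be a compact set whose complement $S^{n-1}\setminus F$ is a countable union of pairwise disjoint open geodesic balls of $S^{n-1}$ (with its standard metric), each of radius at most $\delta_0$ (a "good Cantor set"); if $n=1$, assume moreover $F\neq\emptyset$. Then there are a smooth immersion $x:S^n\to\mathbb{R}^{n+1}$, with Gauss map (smooth unit normal field) $N:S^n\to S^n$ for a suitable orientation, and a number $a\in(0,1)$ such that, viewing $d_pN$ as an endomorphism of $T_pS^n$ (identified with $dx_p(T_pS^n)=N(p)^{\perp}$ through $dx_p$) and writing $H_n(p)=\det(d_pN)$ for the Gauss–Kronecker curvature: 1. $\operatorname{rank}(x):=\min_{p\in S^n}\operatorname{rank}(d_pN)=n-1$; 2. $H_n(p)\ge 0$ for every $p\in S^n$; 3. $\{p\in S^n : H_n(p)=0\}=F\times D^1$, where $D^1=[-a,a]$ and $F\times D^1$ denotes the subset $\{(\sqrt{1-t^2}\,y,\,t) : y\in F,\ |t|\le a\}$ of $S^n\subset\mathbb{R}^n\times\mathbb{R}$. -/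

import Mathlib

open scoped Manifold ContDiff

noncomputable section

/-- The Euclidean space `ℝ^m`. -/
abbrev Euc (m : ℕ) : Type := EuclideanSpace ℝ (Fin m)

/-- The unit sphere of `ℝ^m`, so that `S^n` is `USphere (n + 1)` and `S^(n-1)` is `USphere n`. -/
abbrev USphere (m : ℕ) : Type := Metric.sphere (0 : Euc m) 1

/-- The open ball of the unit sphere with centre `c` and radius `r`, for the standard (geodesic)
distance of the sphere, which is the angle between two unit vectors. -/
def geodesicBall {m : ℕ} (c : USphere m) (r : ℝ) : Set (USphere m) :=
  {y | InnerProductGeometry.angle (c : Euc m) (y : Euc m) < r}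

/-- `F` is compact and its complement is the union of a countable family of pairwise disjoint
round open balls of radius at most `δ`. -/
def IsGoodCantorSet {m : ℕ} (δ : ℝ) (F : Set (USphere m)) : Prop :=
  IsCompact F ∧ ∃ U : Set (Set (USphere m)),
    U.Countable ∧
    (∀ B ∈ U, ∃ c : USphere m, ∃ r : ℝ, 0 < r ∧ r ≤ δ ∧ B = geodesicBall c r) ∧
    U.PairwiseDisjoint id ∧
    Fᶜ = ⋃₀ U

/-- The differential at `p` of a map from `S^n` to `ℝ^(n+1)`. -/
def sphereDiff {n : ℕ} (f : USphere (n + 1) → Euc (n + 1)) (p : USphere (n + 1)) :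
    TangentSpace (𝓡 n) p →ₗ[ℝ] Euc (n + 1) :=
  (mfderiv (𝓡 n) 𝓘(ℝ, Euc (n + 1)) f p).toLinearMap

/-- `x : S^n → ℝ^(n+1)` is a smooth immersion. -/
def IsSmoothImmersion {n : ℕ} (x : USphere (n + 1) → Euc (n + 1)) : Prop :=
  ContMDiff (𝓡 n) 𝓘(ℝ, Euc (n + 1)) ∞ x ∧ ∀ p, Function.Injective (sphereDiff x p)

/-- `N` is a Gauss map of the immersion `x`: a smooth field of unit vectors, normal to `x`.
(There are two of them, one for each orientation of `S^n`.) -/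
def IsGaussMap {n : ℕ} (x N : USphere (n + 1) → Euc (n + 1)) : Prop :=
  ContMDiff (𝓡 n) 𝓘(ℝ, Euc (n + 1)) ∞ N ∧ (∀ p, ‖N p‖ = 1) ∧
    ∀ p, ∀ v : TangentSpace (𝓡 n) p, inner ℝ (N p) (sphereDiff x p v) = 0

/-- The rank of `d_p N`. -/
def gaussRank {n : ℕ} (N : USphere (n + 1) → Euc (n + 1)) (p : USphere (n + 1)) : ℕ :=
  Module.finrank ℝ (LinearMap.range (sphereDiff N p))

/-- `d_p N` as an endomorphism of the tangent space of `S^n` at `p`. The values of `d_p N` are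
orthogonal to `N p`, so they lie in the image of the injective map `d_p x`, and `d_p x` is used
to identify this image with the tangent space. -/
def shapeOperator {n : ℕ} (x N : USphere (n + 1) → Euc (n + 1)) (p : USphere (n + 1)) :
    TangentSpace (𝓡 n) p →ₗ[ℝ] TangentSpace (𝓡 n) p :=
  (sphereDiff x p).leftInverse ∘ₗ sphereDiff N p

/-- The defining property of the endomorphism: `d_p x (A v) = d_p N v`. -/
theorem sphereDiff_shapeOperator {n : ℕ} {x N : USphere (n + 1) → Euc (n + 1)}
    (hx : IsSmoothImmersion x) (hN : IsGaussMap x N) (p : USphere (n + 1))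
    (v : TangentSpace (𝓡 n) p) :
    sphereDiff x p (shapeOperator x N p v) = sphereDiff N p v := by
  have hNd : HasMFDerivAt (𝓡 n) 𝓘(ℝ, Euc (n + 1)) N p
      (mfderiv (𝓡 n) 𝓘(ℝ, Euc (n + 1)) N p) :=
    ((hN.1 p).mdifferentiableAt (by simp)).hasMFDerivAt
  have h1 := (hasStrictFDerivAt_norm_sq (N p)).hasFDerivAt.hasMFDerivAt.comp p hNd
  have h2 : HasMFDerivAt (𝓡 n) 𝓘(ℝ, ℝ) ((fun z : Euc (n + 1) => ‖z‖ ^ 2) ∘ N) p 0 := by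
    have hc : ((fun z : Euc (n + 1) => ‖z‖ ^ 2) ∘ N) = fun _ => (1 : ℝ) := by
      funext q
      simp [hN.2.1 q]
    rw [hc]
    exact hasMFDerivAt_const (1 : ℝ) p
  have h3 : inner ℝ (N p) (sphereDiff N p v) = 0 := by
    have h4 := DFunLike.congr_fun (hasMFDerivAt_unique h1 h2) v
    have h5 : (2 • innerSL ℝ (N p) : Euc (n + 1) →L[ℝ] ℝ) (sphereDiff N p v) = 0 := h4
    simpa using h5
  have hker : LinearMap.ker (sphereDiff x p) = ⊥ := LinearMap.ker_eq_bot.2 (hx.2 p)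
  have hle : LinearMap.range (sphereDiff x p) ≤ (ℝ ∙ N p)ᗮ := by
    rintro _ ⟨w, rfl⟩
    exact Submodule.mem_orthogonal_singleton_iff_inner_right.2 (hN.2.2 p w)
  have hne : N p ≠ 0 := by
    intro h
    have h6 := hN.2.1 p
    simp [h] at h6
  have : Fact (Module.finrank ℝ (Euc (n + 1)) = n + 1) := ⟨by simp⟩
  have hfin : Module.finrank ℝ (LinearMap.range (sphereDiff x p)) = n := by
    rw [LinearMap.finrank_range_of_inj (hx.2 p)]
    exact finrank_euclideanSpace_fin
  have heq := Submodule.eq_of_le_of_finrank_eq hle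
    (hfin.trans (Submodule.finrank_orthogonal_span_singleton hne).symm)
  have hmem : sphereDiff N p v ∈ LinearMap.range (sphereDiff x p) := by
    rw [heq]
    exact Submodule.mem_orthogonal_singleton_iff_inner_right.2 h3
  obtain ⟨w, hw⟩ := hmem
  rw [shapeOperator, LinearMap.comp_apply, ← hw, LinearMap.leftInverse_apply_of_inj hker]

/-- The Gauss-Kronecker curvature `H_n = det (dN)`. -/
def gaussKronecker {n : ℕ} (x N : USphere (n + 1) → Euc (n + 1)) (p : USphere (n + 1)) : ℝ :=
  LinearMap.det (shapeOperator x N p)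

/-- The subset `F × D^1` of `S^n`, where `F ⊆ S^(n-1)` and `D^1 = [-a, a]`: the set of the points
`(√(1 - t²) y, t)` with `y ∈ F` and `|t| ≤ a`. -/
def prodDisk {n : ℕ} (F : Set (USphere n)) (a : ℝ) : Set (USphere (n + 1)) :=
  {p | ∃ y ∈ F, ∃ t ∈ Set.Icc (-a) a,
    (∀ i : Fin n, (p : Euc (n + 1)) i.castSucc = √(1 - t ^ 2) * (y : Euc n) i) ∧
      (p : Euc (n + 1)) (Fin.last n) = t}

end

/-!
The hypersurface is a perturbed round cylinder with two closed ends, given as the level set `q = 1`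
of a positive function `q` on `ℝ^(n+1) = ℝ^n × ℝ ∋ X = (z, s)`, smooth and homogeneous of degree two
off the origin. It is parametrized by `x p = p / √(q p)`, and its Gauss map is the normalized
gradient. By Euler's identity `D²q(p)(p, ·) = Dq(p)`, so `⟨dN v, dx w⟩` is a positive multiple of
`D²q(p)(dx v, dx w)` (`IsGauge.exists_inner_unitGrad_radialMap`). Hence, once `D²q` is positive
semidefinite, `det dN ≥ 0`, and the kernel of `dN` consists of the tangent directions in which
`D²q` degenerates (`IsGauge.sphereDiff_normal_eq_zero_iff`). Everything is thereby reduced to a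
function `q` with `D²q ≥ 0` whose second derivative degenerates exactly over `F × [-a, a]`, and
there only in the direction of the axis.

With `Γ = expNegInvGlue`, the function is
`q = 3 |z|² + s² Γ(1/2 - |z|²/s²) + ε s² φ(z/|z|)²`.
* `3 |z|²` is the cylinder.
* The second summand closes the ends. It vanishes for `s² ≤ 2 |z|²`, that is for `|s| ≤ √(2/3)` on
  the unit sphere; beyond that, its second derivative is at least a positive multiple of `ds²` minus
  a multiple of `|dz|²` that the cylinder absorbs (`le_hess_endPart`).
* In the third summand, `φ` is smooth and vanishes on the unit sphere exactly on `F`, and the factor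
  `φ(z/|z|)` is cut off near the axis, where the second summand dominates. Because `φ` is squared,
  the mixed second derivatives are controlled by the second derivative `2 φ²` along the axis and by
  `|dz|²`, so for small `ε` they do not spoil semidefiniteness (`exists_hess_capGauge_bound`).

The Gauss map does degenerate somewhere, because `F` is nonempty: for `n ≥ 2` the connected sphere
is not a disjoint union of open balls of radius at most `π` (`IsGoodCantorSet.nonempty`).
-/

open Filter Topology

/-! ### Second derivatives along lines -/

/-- The second derivative of `f` at `X`, as a bilinear form. -/
noncomputable def hess {E : Type*} [NormedAddCommGroup E] [NormedSpace ℝ E] (f : E → ℝ) (X : E) :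
    E →L[ℝ] E →L[ℝ] ℝ :=
  fderiv ℝ (fderiv ℝ f) X

/-- `φ` is twice differentiable at `t`, with first derivative `a` and second derivative `b`. -/
def HasTwoJetAt (φ : ℝ → ℝ) (a b t : ℝ) : Prop :=
  ∃ d : ℝ → ℝ, (∀ᶠ u in 𝓝 t, HasDerivAt φ (d u) u) ∧ d t = a ∧ HasDerivAt d b t

namespace HasTwoJetAt

variable {φ ψ : ℝ → ℝ} {a b a' b' t : ℝ}

theorem hasDerivAt (h : HasTwoJetAt φ a b t) : HasDerivAt φ a t := by
  obtain ⟨d, h1, rfl, -⟩ := h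
  exact h1.self_of_nhds

theorem unique (h : HasTwoJetAt φ a b t) (h' : HasTwoJetAt φ a' b' t) : a = a' ∧ b = b' := by
  refine ⟨h.hasDerivAt.unique h'.hasDerivAt, ?_⟩
  obtain ⟨d, h1, -, h2⟩ := h
  obtain ⟨d', h1', -, h2'⟩ := h'
  refine h2.unique (h2'.congr_of_eventuallyEq ?_)
  filter_upwards [h1, h1'] with u hu hu' using hu.unique hu'

theorem congr (h : HasTwoJetAt φ a b t) (e : ψ =ᶠ[𝓝 t] φ) : HasTwoJetAt ψ a b t := by
  obtain ⟨d, h1, h2, h3⟩ := h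
  refine ⟨d, ?_, h2, h3⟩
  filter_upwards [h1, e.eventuallyEq_nhds] with u hu hu' using hu.congr_of_eventuallyEq hu'

theorem add (h : HasTwoJetAt φ a b t) (h' : HasTwoJetAt ψ a' b' t) :
    HasTwoJetAt (fun u => φ u + ψ u) (a + a') (b + b') t := by
  obtain ⟨d, h1, rfl, h3⟩ := h
  obtain ⟨d', h1', rfl, h3'⟩ := h'
  refine ⟨fun u => d u + d' u, ?_, rfl, h3.add h3'⟩
  filter_upwards [h1, h1'] with u hu hu' using hu.add hu'

theorem mul (h : HasTwoJetAt φ a b t) (h' : HasTwoJetAt ψ a' b' t) :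
    HasTwoJetAt (fun u => φ u * ψ u) (a * ψ t + φ t * a') (b * ψ t + 2 * (a * a') + φ t * b') t := by
  have e := h.hasDerivAt
  have e' := h'.hasDerivAt
  obtain ⟨d, h1, rfl, h3⟩ := h
  obtain ⟨d', h1', rfl, h3'⟩ := h'
  refine ⟨fun u => d u * ψ u + φ u * d' u, ?_, rfl, ?_⟩
  · filter_upwards [h1, h1'] with u hu hu' using hu.mul hu'
  · exact ((h3.mul e').add (e.mul h3')).congr_deriv (by ring)

theorem const (c t : ℝ) : HasTwoJetAt (fun _ => c) 0 0 t :=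
  ⟨fun _ => 0, .of_forall fun _ => hasDerivAt_const _ _, rfl, hasDerivAt_const _ _⟩

theorem const_mul (c : ℝ) (h : HasTwoJetAt φ a b t) :
    HasTwoJetAt (fun u => c * φ u) (c * a) (c * b) t := by
  simpa using (const c t).mul h

theorem affine (c v t : ℝ) : HasTwoJetAt (fun u => c + u * v) v 0 t :=
  ⟨fun _ => v, .of_forall fun u => by
    simpa using ((hasDerivAt_id u).mul_const v).const_add c, rfl, hasDerivAt_const _ _⟩

theorem comp (h : HasTwoJetAt φ a b t) (h' : HasTwoJetAt ψ a' b' (φ t)) :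
    HasTwoJetAt (fun u => ψ (φ u)) (a' * a) (b' * a ^ 2 + a' * b) t := by
  have e := h.hasDerivAt
  obtain ⟨d, h1, rfl, h3⟩ := h
  obtain ⟨d', h1', rfl, h3'⟩ := h'
  refine ⟨fun u => d' (φ u) * d u, ?_, rfl, ?_⟩
  · filter_upwards [h1, e.continuousAt.eventually h1'] with u hu hu' using hu'.comp u hu
  · exact ((h3'.comp t e).mul h3).congr_deriv (by simp; ring)

end HasTwoJetAt

section

variable {E : Type*} [NormedAddCommGroup E] [NormedSpace ℝ E]

theorem hasDerivAt_line (X V : E) (u : ℝ) : HasDerivAt (fun u : ℝ => X + u • V) V u := by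
  simpa using ((hasDerivAt_id u).smul_const V).const_add X

theorem tendsto_line (X V : E) : Tendsto (fun u : ℝ => X + u • V) (𝓝 0) (𝓝 X) := by
  simpa using (hasDerivAt_line X V 0).continuousAt.tendsto

theorem ContDiffAt.hasFDerivAt_fderiv {f : E → ℝ} {X : E} (hf : ContDiffAt ℝ 2 f X) :
    HasFDerivAt (fderiv ℝ f) (hess f X) X := by
  have h : ContDiffAt ℝ 1 (fderiv ℝ f) X := hf.fderiv_right (by norm_num)
  exact (h.differentiableAt (by simp)).hasFDerivAt

theorem ContDiffAt.hasTwoJetAt_line {f : E → ℝ} {X : E} (hf : ContDiffAt ℝ 2 f X) (V : E) :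
    HasTwoJetAt (fun u : ℝ => f (X + u • V)) (fderiv ℝ f X V) (hess f X V V) 0 := by
  refine ⟨fun u => fderiv ℝ f (X + u • V) V, ?_, by simp, ?_⟩
  · have h : ∀ᶠ Y in 𝓝 X, DifferentiableAt ℝ f Y := by
      filter_upwards [hf.eventually (by simp)] with Y hY using hY.differentiableAt (by simp)
    filter_upwards [(tendsto_line X V).eventually h] with u hu
    exact hu.hasFDerivAt.comp_hasDerivAt u (hasDerivAt_line X V u)
  · have h := hf.hasFDerivAt_fderiv
    rw [show X = X + (0 : ℝ) • V by simp] at h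
    have h2 := h.comp_hasDerivAt (0 : ℝ) (hasDerivAt_line X V 0)
    have h3 := h2.clm_apply (hasDerivAt_const (0 : ℝ) V)
    simpa using h3

theorem hess_comm {f : E → ℝ} {X : E} (hf : ContDiffAt ℝ 2 f X) (V W : E) :
    hess f X V W = hess f X W V :=
  (hf.isSymmSndFDerivAt (by simp)).eq V W

/-- A null vector of a positive semidefinite second derivative is in its kernel. -/
theorem hess_apply_eq_zero {f : E → ℝ} {X : E} (hf : ContDiffAt ℝ 2 f X)
    (hpos : ∀ V, 0 ≤ hess f X V V) {V : E} (hV : hess f X V V = 0) (W : E) :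
    hess f X V W = 0 := by
  have h : ∀ t : ℝ, 0 ≤ hess f X W W + 2 * t * hess f X V W := by
    intro t
    have := hpos (W + t • V)
    simp only [map_add, map_smul, add_apply, smul_apply,
      smul_eq_mul, hV, hess_comm hf W V] at this
    linarith
  by_contra hne
  have h1 := h (-(hess f X W W + 1) / (2 * hess f X V W))
  have h2 : 2 * (-(hess f X W W + 1) / (2 * hess f X V W)) * hess f X V W
      = -(hess f X W W + 1) := by field_simp
  linarith

/-- Bounds for a `C²` function and its first two derivatives on a compact set. -/
theorem exists_two_jet_bound {f : E → ℝ} {K : Set E} (hK : IsCompact K)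
    (hf : ∀ X ∈ K, ContDiffAt ℝ 2 f X) :
    ∃ M, 0 ≤ M ∧ ∀ X ∈ K, ∀ V, |fderiv ℝ f X V| ≤ M * ‖V‖ ∧ |hess f X V V| ≤ M * ‖V‖ ^ 2 := by
  have c1 : ContinuousOn (fderiv ℝ f) K := fun X hX =>
    (hf X hX).hasFDerivAt_fderiv.continuousAt.continuousWithinAt
  have c2 : ContinuousOn (hess f) K := fun X hX => by
    have h : ContDiffAt ℝ 1 (fderiv ℝ f) X := (hf X hX).fderiv_right (by norm_num)
    have h' : ContDiffAt ℝ 0 (fderiv ℝ (fderiv ℝ f)) X := h.fderiv_right (by norm_num)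
    exact h'.continuousAt.continuousWithinAt
  obtain ⟨M1, h1⟩ := hK.exists_bound_of_continuousOn c1
  obtain ⟨M2, h2⟩ := hK.exists_bound_of_continuousOn (E := E →L[ℝ] E →L[ℝ] ℝ) c2
  refine ⟨max 0 (max M1 M2), le_max_left _ _, fun X hX V => ⟨?_, ?_⟩⟩
  · refine ((fderiv ℝ f X).le_of_opNorm_le (h1 X hX) V).trans ?_
    gcongr
    exact (le_max_left _ _).trans (le_max_right _ _)
  · have := ((hess f X V).le_of_opNorm_le ((hess f X).le_of_opNorm_le (h2 X hX) V) V)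
    rw [mul_assoc, ← sq] at this
    refine this.trans ?_
    gcongr
    exact (le_max_right _ _).trans (le_max_right _ _)

end

/-! ### The flat function `exp (-1/y)` -/

/-- On `(-∞, 1/2]` the function `expNegInvGlue` is nondecreasing and convex, with derivative at
most `2`. -/
theorem expNegInvGlue_hasTwoJetAt {y : ℝ} (hy : y ≤ 1 / 2) :
    ∃ a b, HasTwoJetAt expNegInvGlue a b y ∧ 0 ≤ a ∧ a ≤ 2 ∧ 0 ≤ b ∧ (y ≤ 0 → a = 0 ∧ b = 0) := by
  have h1 := fun x => expNegInvGlue.hasDerivAt_polynomial_eval_inv_mul 1 x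
  have h2 := expNegInvGlue.hasDerivAt_polynomial_eval_inv_mul (Polynomial.X ^ 2) y
  simp only [Polynomial.eval_one, one_mul, Polynomial.derivative_one, sub_zero, mul_one,
    Polynomial.eval_pow, Polynomial.eval_X, Polynomial.derivative_X_pow, Polynomial.eval_mul,
    Polynomial.eval_sub, Polynomial.eval_C] at h1 h2
  refine ⟨_, _, ⟨_, .of_forall h1, rfl, h2⟩, ?_, ?_, ?_, ?_⟩
  · exact mul_nonneg (sq_nonneg _) (expNegInvGlue.nonneg _)
  · rcases le_or_gt y 0 with h | h
    · simp [expNegInvGlue.zero_of_nonpos h]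
    · rw [expNegInvGlue, if_neg h.not_ge, Real.exp_neg, ← div_eq_mul_inv,
        div_le_iff₀ (Real.exp_pos _)]
      have := Real.quadratic_le_exp_of_nonneg (inv_nonneg.2 h.le)
      have := inv_nonneg.2 h.le
      linarith
  · rcases le_or_gt y 0 with h | h
    · simp [expNegInvGlue.zero_of_nonpos h]
    · refine mul_nonneg (mul_nonneg (sq_nonneg _) ?_) (expNegInvGlue.nonneg _)
      have h3 : 2 ≤ y⁻¹ := by
        rw [le_inv_comm₀ two_pos h]; linarith
      have h4 : 0 ≤ y⁻¹ ^ 2 - 2 * y⁻¹ := by nlinarith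
      simpa using h4
  · intro h
    simp [expNegInvGlue.zero_of_nonpos h]

/-! ### The cylinder closed by two strictly convex ends -/

theorem two_le_infty : (2 : WithTop ℕ∞) ≤ ∞ :=
  WithTop.coe_le_coe.2 (le_top : (2 : ℕ∞) ≤ ⊤)

section

variable {n : ℕ}

/-- The component in `ℝ^n` of a vector of `ℝ^(n+1) = ℝ^n × ℝ`. -/
noncomputable def base : Euc (n + 1) →L[ℝ] Euc n :=
  LinearMap.toContinuousLinearMap
    { toFun := fun X => WithLp.toLp 2 fun i => X i.castSucc
      map_add' := fun _ _ => rfl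
      map_smul' := fun _ _ => rfl }

/-- The component in `ℝ` of a vector of `ℝ^(n+1) = ℝ^n × ℝ`. -/
noncomputable def height : Euc (n + 1) →L[ℝ] ℝ :=
  EuclideanSpace.proj (Fin.last n)

theorem base_apply (X : Euc (n + 1)) (i : Fin n) : base X i = X i.castSucc := rfl

theorem height_apply (X : Euc (n + 1)) : height X = X (Fin.last n) := rfl

theorem norm_sq_eq_base_add_height (X : Euc (n + 1)) :
    ‖X‖ ^ 2 = ‖base X‖ ^ 2 + height X ^ 2 := by
  simp [EuclideanSpace.norm_sq_eq, Fin.sum_univ_castSucc, base_apply, height_apply]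

/-- The unit vector of the axis `{0} × ℝ`. -/
noncomputable def axis : Euc (n + 1) := EuclideanSpace.single (Fin.last n) 1

@[simp] theorem base_axis : base (axis : Euc (n + 1)) = 0 := by
  ext i
  simp [base_apply, axis, (Fin.castSucc_lt_last i).ne]

@[simp] theorem height_axis : height (axis : Euc (n + 1)) = 1 := by
  simp [height_apply, axis]

theorem eq_smul_axis {X : Euc (n + 1)} (h : base X = 0) : X = height X • axis := by
  ext i
  induction i using Fin.lastCases with
  | last => simp [height_apply, axis]
  | cast i =>
    have := congrArg (fun z : Euc n => z i) h
    simp only [base_apply, PiLp.zero_apply] at this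
    simp [this, axis, (Fin.castSucc_lt_last i).ne]

theorem hasTwoJetAt_norm_sq_base (X V : Euc (n + 1)) :
    HasTwoJetAt (fun u : ℝ => ‖base (X + u • V)‖ ^ 2) (2 * inner ℝ (base X) (base V))
      (2 * ‖base V‖ ^ 2) 0 := by
  have h : (fun u : ℝ => ‖base (X + u • V)‖ ^ 2) = fun u : ℝ =>
      ‖base X‖ ^ 2 + u * (2 * inner ℝ (base X) (base V))
        + ‖base V‖ ^ 2 * ((0 + u * 1) * (0 + u * 1)) := by
    funext u
    rw [map_add, map_smul, norm_add_sq_real, norm_smul, inner_smul_right, mul_pow,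
      Real.norm_eq_abs, sq_abs]
    ring
  rw [h]
  have := (HasTwoJetAt.affine (‖base X‖ ^ 2) (2 * inner ℝ (base X) (base V)) 0).add
    (((HasTwoJetAt.affine 0 1 0).mul (HasTwoJetAt.affine 0 1 0)).const_mul (‖base V‖ ^ 2))
  convert this using 1 <;> norm_num
  ring

theorem hasTwoJetAt_height_sq (X V : Euc (n + 1)) :
    HasTwoJetAt (fun u : ℝ => height (X + u • V) ^ 2) (2 * (height X * height V))
      (2 * height V ^ 2) 0 := by
  have h : (fun u : ℝ => height (X + u • V) ^ 2) = fun u : ℝ =>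
      (height X + u * height V) * (height X + u * height V) := by
    funext u
    simp [sq]
  rw [h]
  convert (HasTwoJetAt.affine (height X) (height V) 0).mul
    (HasTwoJetAt.affine (height X) (height V) 0) using 1 <;> simp <;> ring

/-- The quotient `1/2 - |z|²/s²`, nonpositive exactly on the cone `s² ≤ 2 |z|²`. As a single
fraction it has the junk value `0` for `s = 0`, which is consistent with this. -/
noncomputable def endRatio (X : Euc (n + 1)) : ℝ :=
  (height X ^ 2 / 2 - ‖base X‖ ^ 2) / height X ^ 2

/-- The degree two homogeneous function `s² Γ(1/2 - |z|²/s²)` with `Γ = expNegInvGlue`, which closes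
the ends of the cylinder: it vanishes exactly for `s² ≤ 2 |z|²`. -/
noncomputable def endPart (X : Euc (n + 1)) : ℝ :=
  height X ^ 2 * expNegInvGlue (endRatio X)

theorem base_ne_zero_of_height {X : Euc (n + 1)} (hX : X ≠ 0) (h : height X = 0) :
    base X ≠ 0 := fun h' => hX (by rw [eq_smul_axis h', h, zero_smul])

theorem endRatio_nonpos_iff {X : Euc (n + 1)} :
    endRatio X ≤ 0 ↔ height X ^ 2 ≤ 2 * ‖base X‖ ^ 2 := by
  rcases eq_or_ne (height X) 0 with h | h
  · simp [endRatio, h]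
  · have : 0 < height X ^ 2 := by positivity
    rw [endRatio, div_le_iff₀ this]
    constructor <;> intro <;> linarith

theorem endRatio_le_half (X : Euc (n + 1)) : endRatio X ≤ 1 / 2 := by
  rcases eq_or_ne (height X) 0 with h | h
  · simp [endRatio, h]
  · have : 0 < height X ^ 2 := by positivity
    rw [endRatio, div_le_iff₀ this]
    linarith [sq_nonneg ‖base X‖]

theorem endPart_eventuallyEq_zero {X : Euc (n + 1)} (hX : X ≠ 0) (h : height X = 0) :
    endPart =ᶠ[𝓝 X] fun _ => 0 := by
  have h1 : 0 < ‖base X‖ := norm_pos_iff.2 (base_ne_zero_of_height hX h)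
  have hc : Continuous fun Y : Euc (n + 1) => 2 * ‖base Y‖ ^ 2 - height Y ^ 2 := by fun_prop
  have h2 : 0 < 2 * ‖base X‖ ^ 2 - height X ^ 2 := by rw [h]; simp [h1]
  filter_upwards [hc.continuousAt.eventually (lt_mem_nhds h2)] with Y hY
  rw [endPart, expNegInvGlue.zero_of_nonpos (endRatio_nonpos_iff.2 (by linarith)), mul_zero]

theorem contDiffAt_endRatio {X : Euc (n + 1)} (h : height X ≠ 0) :
    ContDiffAt ℝ ∞ endRatio X := by
  have h1 : ContDiff ℝ ∞ fun Y : Euc (n + 1) => ‖base Y‖ ^ 2 := base.contDiff.norm_sq ℝ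
  have h2 : ContDiff ℝ ∞ fun Y : Euc (n + 1) => height Y ^ 2 := height.contDiff.pow 2
  exact ((h2.div_const 2).sub h1).contDiffAt.div h2.contDiffAt (pow_ne_zero 2 h)

theorem contDiffAt_endPart {X : Euc (n + 1)} (hX : X ≠ 0) : ContDiffAt ℝ ∞ endPart X := by
  by_cases h : height X = 0
  · exact contDiffAt_const.congr_of_eventuallyEq (endPart_eventuallyEq_zero hX h)
  · have h2 : ContDiff ℝ ∞ fun Y : Euc (n + 1) => height Y ^ 2 := height.contDiff.pow 2
    have h3 : ContDiff ℝ ∞ expNegInvGlue := expNegInvGlue.contDiff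
    exact h2.contDiffAt.mul (h3.contDiffAt.comp X (contDiffAt_endRatio h))

/-- The ends are convex up to a multiple of `|z|²`: this is the convexity of the perspective
`v Γ(1/2 - u/v)` in `(u, v) = (|z|², s²)`. -/
theorem le_hess_endPart {X : Euc (n + 1)} (hX : X ≠ 0) (V : Euc (n + 1)) :
    2 * expNegInvGlue (endRatio X) * height V ^ 2 - 4 * ‖base V‖ ^ 2 ≤ hess endPart X V V ∧
      (endRatio X ≤ 0 → hess endPart X V V = 0) := by
  have hsm : ContDiffAt ℝ 2 endPart X := (contDiffAt_endPart hX).of_le two_le_infty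
  have hjet := hsm.hasTwoJetAt_line V
  by_cases h : height X = 0
  · have h0 := (hjet.unique ((HasTwoJetAt.const 0 0).congr
      ((tendsto_line X V).eventually (endPart_eventuallyEq_zero hX h)))).2
    rw [h0]
    simp only [endRatio, h]
    simp
  · have hr : ContDiffAt ℝ 2 endRatio X := (contDiffAt_endRatio h).of_le two_le_infty
    have jr := hr.hasTwoJetAt_line V
    set y1 := fderiv ℝ endRatio X V
    set y2 := hess endRatio X V V
    have jv := hasTwoJetAt_height_sq X V
    have ju := hasTwoJetAt_norm_sq_base X V
    -- `s² y = s²/2 - |z|²`, differentiated twice, expresses the second derivative of `y`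
    have e : (fun u : ℝ => height (X + u • V) ^ 2 / 2 - ‖base (X + u • V)‖ ^ 2) =ᶠ[𝓝 0]
        fun u : ℝ => height (X + u • V) ^ 2 * endRatio (X + u • V) := by
      have := (height.continuous.continuousAt.eventually_ne h)
      filter_upwards [(tendsto_line X V).eventually this] with u hu
      rw [endRatio, mul_div_cancel₀]
      exact pow_ne_zero 2 hu
    have j2 := ((jv.const_mul (1 / 2)).add (ju.const_mul (-1))).congr (ψ := fun u : ℝ =>
      height (X + u • V) ^ 2 / 2 - ‖base (X + u • V)‖ ^ 2) (.of_forall fun u => by ring)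
    have hy := (((jv.mul jr).congr e).unique j2).2
    obtain ⟨a, b, jΓ, ha, ha2, hb, hab⟩ := expNegInvGlue_hasTwoJetAt (endRatio_le_half X)
    have j3 := jv.mul (jr.comp (ψ := expNegInvGlue) (by simpa using jΓ))
    have hh := (hjet.unique j3).2
    simp only [zero_smul, add_zero] at hy hh
    have hle := endRatio_le_half X
    -- the terms with the second derivative of `y` cancel by `hy`
    have key : hess endPart X V V = 2 * height V ^ 2 * (expNegInvGlue (endRatio X)
        + a * (1 / 2 - endRatio X)) - 2 * a * ‖base V‖ ^ 2 + height X ^ 2 * b * y1 ^ 2 := by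
      rw [hh]
      linear_combination a * hy
    rw [key]
    constructor
    · have h1 : 0 ≤ 2 * height V ^ 2 * (a * (1 / 2 - endRatio X)) := by
        have : 0 ≤ 1 / 2 - endRatio X := by linarith
        positivity
      have h2 : 0 ≤ height X ^ 2 * b * y1 ^ 2 := by positivity
      have h3 : 0 ≤ (2 - a) * ‖base V‖ ^ 2 := mul_nonneg (by linarith) (by positivity)
      linarith
    · intro h0
      obtain ⟨rfl, rfl⟩ := hab h0
      rw [expNegInvGlue.zero_of_nonpos h0]
      ring

theorem endPart_smul {c : ℝ} (hc : 0 < c) (X : Euc (n + 1)) :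
    endPart (c • X) = c ^ 2 * endPart X := by
  have h : endRatio (c • X) = endRatio X := by
    rcases eq_or_ne (height X) 0 with h | h
    · simp [endRatio, h]
    · simp only [endRatio, map_smul, norm_smul, smul_eq_mul, Real.norm_eq_abs, mul_pow, sq_abs]
      have := hc.ne'
      field_simp
  rw [endPart, h, endPart, map_smul, smul_eq_mul]
  ring

/-! ### The perturbation of the cylinder off the cone over `F` -/

/-- The extension of `φ`, homogeneous of degree zero, from the unit sphere. -/
noncomputable def radialExt (φ : Euc n → ℝ) (z : Euc n) : ℝ := φ (‖z‖⁻¹ • z)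

theorem contDiffAt_radialExt {φ : Euc n → ℝ} (hφ : ContDiff ℝ ∞ φ) {z : Euc n} (hz : z ≠ 0) :
    ContDiffAt ℝ ∞ (radialExt φ) z :=
  hφ.contDiffAt.comp z (((contDiffAt_norm ℝ hz).inv (norm_ne_zero_iff.2 hz)).smul contDiffAt_id)

theorem radialExt_smul (φ : Euc n → ℝ) {c : ℝ} (hc : 0 < c) (z : Euc n) :
    radialExt φ (c • z) = radialExt φ z := by
  rw [radialExt, radialExt, norm_smul, smul_smul, Real.norm_eq_abs, abs_of_pos hc]
  congr 2
  have := hc.ne'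
  field_simp

/-- A cutoff, homogeneous of degree zero: `1` where `6 |z|² ≥ |X|²` and `0` where `7 |z|² ≤ |X|²`. -/
noncomputable def axisCutoff (X : Euc (n + 1)) : ℝ :=
  Real.smoothTransition (42 * (‖base X‖ ^ 2 / ‖X‖ ^ 2) - 6)

theorem contDiffAt_axisCutoff {X : Euc (n + 1)} (hX : X ≠ 0) : ContDiffAt ℝ ∞ axisCutoff X := by
  have h1 : ContDiff ℝ ∞ fun Y : Euc (n + 1) => ‖base Y‖ ^ 2 := base.contDiff.norm_sq ℝ
  have h2 : ContDiff ℝ ∞ fun Y : Euc (n + 1) => ‖Y‖ ^ 2 := contDiff_id.norm_sq ℝ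
  have h3 : ContDiff ℝ ∞ Real.smoothTransition := Real.smoothTransition.contDiff
  refine h3.contDiffAt.comp X ?_
  refine (contDiffAt_const.mul (h1.contDiffAt.div h2.contDiffAt ?_)).sub contDiffAt_const
  exact pow_ne_zero 2 (norm_ne_zero_iff.2 hX)

/-- The function `s φ(z/|z|)`, cut off near the axis. -/
noncomputable def ripple (φ : Euc n → ℝ) (X : Euc (n + 1)) : ℝ :=
  height X * (axisCutoff X * radialExt φ (base X))

theorem contDiffAt_ripple {φ : Euc n → ℝ} (hφ : ContDiff ℝ ∞ φ) {X : Euc (n + 1)} (hX : X ≠ 0) :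
    ContDiffAt ℝ ∞ (ripple φ) X := by
  refine height.contDiff.contDiffAt.mul ?_
  by_cases h : base X = 0
  · have h0 : ContinuousAt (fun Y : Euc (n + 1) => 42 * (‖base Y‖ ^ 2 / ‖Y‖ ^ 2) - 6) X := by
      have : ‖X‖ ^ 2 ≠ 0 := pow_ne_zero 2 (norm_ne_zero_iff.2 hX)
      fun_prop (disch := assumption)
    have h1 : 42 * (‖base X‖ ^ 2 / ‖X‖ ^ 2) - 6 < 0 := by simp [h]
    refine (contDiffAt_const (c := (0 : ℝ))).congr_of_eventuallyEq ?_
    filter_upwards [h0.eventually (gt_mem_nhds h1)] with Y hY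
    rw [axisCutoff, Real.smoothTransition.zero_of_nonpos hY.le, zero_mul]
  · exact (contDiffAt_axisCutoff hX).mul
      ((contDiffAt_radialExt hφ h).comp X base.contDiff.contDiffAt)

theorem ripple_smul (φ : Euc n → ℝ) {c : ℝ} (hc : 0 < c) (X : Euc (n + 1)) :
    ripple φ (c • X) = c * ripple φ X := by
  have h : axisCutoff (c • X) = axisCutoff X := by
    simp only [axisCutoff, map_smul, norm_smul, Real.norm_eq_abs, mul_pow, sq_abs]
    rw [mul_div_mul_left _ _ (pow_ne_zero 2 hc.ne')]
  rw [ripple, h, ripple, map_smul, map_smul, radialExt_smul φ hc, smul_eq_mul]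
  ring

theorem ripple_eventuallyEq {φ : Euc n → ℝ} {X : Euc (n + 1)} (hX : X ≠ 0)
    (h : height X ^ 2 ≤ 4 * ‖base X‖ ^ 2) :
    ripple φ =ᶠ[𝓝 X] fun Y => height Y * radialExt φ (base Y) := by
  have h0 : Continuous fun Y : Euc (n + 1) => 6 * ‖base Y‖ ^ 2 - ‖Y‖ ^ 2 := by fun_prop
  have h2 : 0 < ‖X‖ := norm_pos_iff.2 hX
  have h1 : 0 < 6 * ‖base X‖ ^ 2 - ‖X‖ ^ 2 := by
    have := norm_sq_eq_base_add_height X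
    have : 0 < ‖X‖ ^ 2 := by positivity
    linarith
  filter_upwards [h0.continuousAt.eventually (lt_mem_nhds h1),
    continuous_norm.continuousAt.eventually (lt_mem_nhds h2)] with Y hY hY'
  have h3 : 1 / 6 ≤ ‖base Y‖ ^ 2 / ‖Y‖ ^ 2 := by
    rw [le_div_iff₀ (by positivity)]
    linarith
  rw [ripple, axisCutoff, Real.smoothTransition.one_of_one_le (by linarith), one_mul]

/-- Away from the axis the square of `s φ(z/|z|)` has an explicit second derivative; as
`φ` enters squared, its mixed part is controlled by the part in the direction of the axis. -/
theorem hess_ripple_sq {φ : Euc n → ℝ} (hφ : ContDiff ℝ ∞ φ) {X : Euc (n + 1)} (hX : X ≠ 0)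
    (h : height X ^ 2 ≤ 4 * ‖base X‖ ^ 2) (V : Euc (n + 1)) :
    hess (fun Y => ripple φ Y ^ 2) X V V =
      2 * (height V * radialExt φ (base X)
        + height X * fderiv ℝ (radialExt φ) (base X) (base V)) ^ 2
      + 2 * (height X * radialExt φ (base X)) *
        (2 * height V * fderiv ℝ (radialExt φ) (base X) (base V)
          + height X * hess (radialExt φ) (base X) (base V) (base V)) := by
  have hb : base X ≠ 0 := by
    intro h0
    rw [h0, norm_zero] at h
    have : height X = 0 := by nlinarith
    exact base_ne_zero_of_height hX this h0
  have hsm : ContDiffAt ℝ 2 (fun Y => ripple φ Y ^ 2) X :=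
    ((contDiffAt_ripple hφ hX).pow 2).of_le two_le_infty
  have hr : ContDiffAt ℝ 2 (radialExt φ) (base X) :=
    (contDiffAt_radialExt hφ hb).of_le two_le_infty
  have j := (HasTwoJetAt.affine (height X) (height V) 0).mul (hr.hasTwoJetAt_line (base V))
  have j2 := (j.mul j).congr (ψ := fun u : ℝ => ripple φ (X + u • V) ^ 2) (by
    filter_upwards [(tendsto_line X V).eventually (ripple_eventuallyEq (φ := φ) hX h)] with u hu
    rw [hu]
    simp only [map_add, map_smul, smul_eq_mul]
    ring)
  rw [((hsm.hasTwoJetAt_line V).unique j2).2]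
  simp
  ring

/-! ### The gauge -/

/-- The degree two homogeneous function whose level set is the hypersurface: a quadratic cylinder,
closed by `endPart`, and perturbed off the cone over the zero set of `φ`. -/
noncomputable def capGauge (φ : Euc n → ℝ) (ε : ℝ) (X : Euc (n + 1)) : ℝ :=
  3 * ‖base X‖ ^ 2 + endPart X + ε * ripple φ X ^ 2

theorem contDiffAt_capGauge {φ : Euc n → ℝ} (hφ : ContDiff ℝ ∞ φ) (ε : ℝ) {X : Euc (n + 1)}
    (hX : X ≠ 0) : ContDiffAt ℝ ∞ (capGauge φ ε) X := by
  have h1 : ContDiff ℝ ∞ fun Y : Euc (n + 1) => ‖base Y‖ ^ 2 := base.contDiff.norm_sq ℝ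
  exact ((contDiffAt_const.mul h1.contDiffAt).add (contDiffAt_endPart hX)).add
    (contDiffAt_const.mul ((contDiffAt_ripple hφ hX).pow 2))

theorem capGauge_smul (φ : Euc n → ℝ) (ε : ℝ) {c : ℝ} (hc : 0 < c) (X : Euc (n + 1)) :
    capGauge φ ε (c • X) = c ^ 2 * capGauge φ ε X := by
  rw [capGauge, capGauge, endPart_smul hc, ripple_smul φ hc, map_smul, norm_smul, Real.norm_eq_abs,
    mul_pow, sq_abs]
  ring

theorem capGauge_pos (φ : Euc n → ℝ) {ε : ℝ} (hε : 0 ≤ ε) {X : Euc (n + 1)} (hX : X ≠ 0) :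
    0 < capGauge φ ε X := by
  have h2 : 0 ≤ endPart X := mul_nonneg (sq_nonneg _) (expNegInvGlue.nonneg _)
  have h3 : 0 ≤ ε * ripple φ X ^ 2 := by positivity
  by_cases h : base X = 0
  · have h4 : height X ≠ 0 := fun h' => base_ne_zero_of_height hX h' h
    have h5 : 0 < endPart X := by
      have : 0 < endRatio X := by
        rw [← not_le, endRatio_nonpos_iff, h, not_le]
        have : 0 < height X ^ 2 := by positivity
        simpa using this
      have := expNegInvGlue.pos_of_pos this
      unfold endPart
      positivity
    have : 0 ≤ 3 * ‖base X‖ ^ 2 := by positivity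
    unfold capGauge
    linarith
  · have : 0 < ‖base X‖ := norm_pos_iff.2 h
    have : 0 < 3 * ‖base X‖ ^ 2 := by positivity
    unfold capGauge
    linarith

theorem hess_capGauge {φ : Euc n → ℝ} (hφ : ContDiff ℝ ∞ φ) (ε : ℝ) {X : Euc (n + 1)}
    (hX : X ≠ 0) (V : Euc (n + 1)) :
    hess (capGauge φ ε) X V V = 6 * ‖base V‖ ^ 2 + hess endPart X V V
      + ε * hess (fun Y => ripple φ Y ^ 2) X V V := by
  have h1 : ContDiffAt ℝ 2 (capGauge φ ε) X := (contDiffAt_capGauge hφ ε hX).of_le two_le_infty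
  have h2 : ContDiffAt ℝ 2 endPart X := (contDiffAt_endPart hX).of_le two_le_infty
  have h3 : ContDiffAt ℝ 2 (fun Y => ripple φ Y ^ 2) X :=
    ((contDiffAt_ripple hφ hX).pow 2).of_le two_le_infty
  have j := (((hasTwoJetAt_norm_sq_base X V).const_mul 3).add (h2.hasTwoJetAt_line V)).add
    ((h3.hasTwoJetAt_line V).const_mul ε)
  rw [((h1.hasTwoJetAt_line V).unique j).2]
  ring

/-- For small `ε`, the second derivative of the gauge at a unit vector is positive semidefinite; it
is definite except on the part `s² ≤ 2 |z|²` of the cone over the zero set of `φ`, where it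
degenerates in the direction of the axis only. -/
theorem exists_hess_capGauge_bound {φ : Euc n → ℝ} (hφ : ContDiff ℝ ∞ φ) (hφ1 : ∀ z, |φ z| ≤ 1) :
    ∃ ε, 0 < ε ∧ ∀ p : Euc (n + 1), ‖p‖ = 1 →
      ∃ μ, 0 ≤ μ ∧
        (μ = 0 ↔ height p ^ 2 ≤ 2 * ‖base p‖ ^ 2 ∧ radialExt φ (base p) = 0) ∧
        (∀ V, ‖base V‖ ^ 2 + μ * height V ^ 2 ≤ hess (capGauge φ ε) p V V) ∧
        (μ = 0 → hess (capGauge φ ε) p axis axis = 0) := by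
  -- for a unit vector with `s² ≤ 4 |z|²` one has `|z|² ≥ 1/5`
  have hK : IsCompact (Metric.closedBall (0 : Euc n) 1 \ Metric.ball 0 (1 / 3)) :=
    (isCompact_closedBall _ _).diff Metric.isOpen_ball
  obtain ⟨M, hM, hbd⟩ := exists_two_jet_bound (f := radialExt φ) hK fun z hz =>
    (contDiffAt_radialExt hφ (by rintro rfl; simp at hz)).of_le two_le_infty
  obtain ⟨M', hM', hbd'⟩ := exists_two_jet_bound (f := fun Y => ripple φ Y ^ 2)
    (isCompact_sphere (0 : Euc (n + 1)) 1) fun p hp =>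
    ((contDiffAt_ripple hφ (ne_zero_of_mem_unit_sphere ⟨p, hp⟩)).pow 2).of_le
      two_le_infty
  have hΓ : 0 < expNegInvGlue (1 / 4) := expNegInvGlue.pos_of_pos (by norm_num)
  set Γ := expNegInvGlue (1 / 4)
  obtain ⟨ε, hε, hε1, hε2, hε3⟩ : ∃ ε, 0 < ε ∧ ε * (14 * M ^ 2 + 2 * M) ≤ 1 ∧ ε * M' ≤ 1 ∧
      ε * M' ≤ Γ := by
    have : ∀ a b : ℝ, 0 ≤ a → 0 < b → ∃ e, 0 < e ∧ ∀ e' ≤ e, e' * a ≤ b := fun a b ha hb =>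
      ⟨b / (a + 1), by positivity, fun e' he => by
        calc e' * a ≤ b / (a + 1) * a := by gcongr
          _ ≤ b := by rw [div_mul_eq_mul_div, div_le_iff₀ (by positivity)]; nlinarith⟩
    obtain ⟨e1, p1, h1⟩ := this (14 * M ^ 2 + 2 * M) 1 (by positivity) one_pos
    obtain ⟨e2, p2, h2⟩ := this M' 1 hM' one_pos
    obtain ⟨e3, p3, h3⟩ := this M' Γ hM' hΓ
    exact ⟨min e1 (min e2 e3), by positivity, h1 _ (min_le_left _ _),
      h2 _ ((min_le_right _ _).trans (min_le_left _ _)),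
      h3 _ ((min_le_right _ _).trans (min_le_right _ _))⟩
  refine ⟨ε, hε, fun p hp => ?_⟩
  have hp0 : p ≠ 0 := by rintro rfl; simp at hp
  have hns := norm_sq_eq_base_add_height p
  rw [hp, one_pow] at hns
  -- where `s² ≤ 4 |z|²` the cutoff is `1`; elsewhere the end is uniformly convex along the axis
  by_cases hcase : height p ^ 2 ≤ 4 * ‖base p‖ ^ 2
  · refine ⟨2 * expNegInvGlue (endRatio p) + ε * radialExt φ (base p) ^ 2, ?_, ?_, ?_, ?_⟩
    · have := expNegInvGlue.nonneg (endRatio p)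
      positivity
    · have h1 := expNegInvGlue.nonneg (endRatio p)
      rw [add_eq_zero_iff_of_nonneg (by positivity) (by positivity)]
      simp [hε.ne', endRatio_nonpos_iff]
    · intro V
      have hk : base p ∈ Metric.closedBall (0 : Euc n) 1 \ Metric.ball 0 (1 / 3) := by
        have := norm_nonneg (base p)
        simp only [Set.mem_sdiff, Metric.mem_closedBall, dist_zero_right, Metric.mem_ball, not_lt]
        constructor <;> nlinarith
      obtain ⟨b1, b2⟩ := hbd _ hk (base V)
      have hs : height p ^ 2 ≤ 1 := by nlinarith [sq_nonneg ‖base p‖]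
      have hs' : |height p| ≤ 1 := (sq_le_one_iff_abs_le_one _).1 hs
      have hη : |radialExt φ (base p)| ≤ 1 := hφ1 _
      rw [hess_capGauge hφ ε hp0, hess_ripple_sq hφ hp0 hcase]
      have hE := (le_hess_endPart hp0 V).1
      set σ := height V
      set s := height p
      set η := radialExt φ (base p)
      set d := fderiv ℝ (radialExt φ) (base p) (base V)
      set d2 := hess (radialExt φ) (base p) (base V) (base V)
      set ζ := ‖base V‖
      have c1 : (s * d) ^ 2 ≤ M ^ 2 * ζ ^ 2 := by
        rw [mul_pow, ← mul_pow M, ← sq_abs d]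
        have : |d| ^ 2 ≤ (M * ζ) ^ 2 := by gcongr
        calc s ^ 2 * |d| ^ 2 ≤ 1 * (M * ζ) ^ 2 := by gcongr
          _ = _ := one_mul _
      have c2 : -(M * ζ ^ 2) ≤ s ^ 2 * η * d2 := by
        refine (abs_le.1 ?_).1
        rw [abs_mul, abs_mul, abs_of_nonneg (sq_nonneg s)]
        calc s ^ 2 * |η| * |d2| ≤ 1 * 1 * (M * ζ ^ 2) := by gcongr
          _ = _ := by ring
      have c3 : η ^ 2 * σ ^ 2 - (14 * M ^ 2 + 2 * M) * ζ ^ 2 ≤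
          2 * (σ * η + s * d) ^ 2 + 2 * (s * η) * (2 * σ * d + s * d2) := by
        -- with `A = σ η` and `B = s d`: `2 (A + B)² + 4 A B = A² + (A + 4 B)² - 14 B²`
        nlinarith [sq_nonneg (σ * η + 4 * (s * d))]
      have c4 := mul_le_mul_of_nonneg_left c3 hε.le
      have c5 : ε * (14 * M ^ 2 + 2 * M) * ζ ^ 2 ≤ 1 * ζ ^ 2 := by gcongr
      linarith [sq_nonneg ζ]
    · intro h0
      have h1 := expNegInvGlue.nonneg (endRatio p)
      rw [add_eq_zero_iff_of_nonneg (by positivity) (by positivity)] at h0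
      simp only [mul_eq_zero, OfNat.ofNat_ne_zero, false_or, hε.ne', expNegInvGlue.zero_iff_nonpos,
        ne_eq, not_false_eq_true, pow_eq_zero_iff] at h0
      rw [hess_capGauge hφ ε hp0, hess_ripple_sq hφ hp0 hcase, (le_hess_endPart hp0 _).2 h0.1, h0.2]
      simp
  · push Not at hcase
    have hs : 0 < height p ^ 2 := lt_of_le_of_lt (by positivity) hcase
    have hr : 1 / 4 ≤ endRatio p := by
      rw [endRatio, le_div_iff₀ hs]
      linarith
    refine ⟨Γ, hΓ.le, ?_, ?_, fun h => absurd h hΓ.ne'⟩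
    · refine ⟨fun h => absurd h hΓ.ne', fun h => ?_⟩
      linarith [h.1, sq_nonneg ‖base p‖]
    · intro V
      have hE := (le_hess_endPart hp0 V).1
      have hm : Γ ≤ expNegInvGlue (endRatio p) := expNegInvGlue.monotone hr
      have hb := (abs_le.1 (hbd' p (by simpa using hp) V).2).1
      rw [norm_sq_eq_base_add_height V] at hb
      rw [hess_capGauge hφ ε hp0]
      have c1 := mul_le_mul_of_nonneg_left hb hε.le
      have c2 : ε * M' * ‖base V‖ ^ 2 ≤ 1 * ‖base V‖ ^ 2 := by gcongr
      have c3 : ε * M' * height V ^ 2 ≤ Γ * height V ^ 2 := by gcongr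
      have c4 : Γ * height V ^ 2 ≤ expNegInvGlue (endRatio p) * height V ^ 2 := by gcongr
      linarith
end

/-! ### Radial hypersurfaces of degree two homogeneous functions -/

section

variable {E : Type*} [NormedAddCommGroup E] [InnerProductSpace ℝ E]

/-- A function which is smooth, positive and homogeneous of degree two off the origin. -/
structure IsGauge (q : E → ℝ) : Prop where
  contDiffAt : ∀ {X}, X ≠ 0 → ContDiffAt ℝ ∞ q X
  smul : ∀ {c : ℝ}, 0 < c → ∀ X, q (c • X) = c ^ 2 * q X
  pos : ∀ {X}, X ≠ 0 → 0 < q X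

/-- The parametrization, by directions, of the level set `q = 1`. -/
noncomputable def radialMap (q : E → ℝ) (X : E) : E := (√(q X))⁻¹ • X

namespace IsGauge

variable {q : E → ℝ} (hq : IsGauge q) {X : E}
include hq

theorem contDiffAt_two (hX : X ≠ 0) : ContDiffAt ℝ 2 q X :=
  (hq.contDiffAt hX).of_le two_le_infty

/-- Euler's identity. -/
theorem fderiv_self (hX : X ≠ 0) : fderiv ℝ q X X = 2 * q X := by
  have h1 : HasDerivAt (fun c : ℝ => q (c • X)) (fderiv ℝ q X X) 1 := by
    have h := ((hq.contDiffAt hX).differentiableAt (by simp)).hasFDerivAt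
    rw [show X = (1 : ℝ) • X by simp] at h
    have h2 : HasDerivAt (fun c : ℝ => c • X) X 1 := by
      simpa using (hasDerivAt_id (1 : ℝ)).smul_const X
    have h4 := h.comp_hasDerivAt (1 : ℝ) h2
    simp only [one_smul] at h4
    exact h4
  have h3 : HasDerivAt (fun c : ℝ => c ^ 2 * q X) (2 * q X) 1 := by
    simpa using ((hasDerivAt_id (1 : ℝ)).pow 2).mul_const (q X)
  refine h1.unique (h3.congr_of_eventuallyEq ?_)
  filter_upwards [lt_mem_nhds (one_pos : (0 : ℝ) < 1)] with c hc using hq.smul hc X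

theorem fderiv_smul {c : ℝ} (hc : 0 < c) (hX : X ≠ 0) :
    fderiv ℝ q (c • X) = c • fderiv ℝ q X := by
  have h1 := ((hq.contDiffAt (smul_ne_zero hc.ne' hX)).differentiableAt (by simp)).hasFDerivAt
  have h2 : HasFDerivAt (fun Y : E => c • Y) (c • ContinuousLinearMap.id ℝ E) X :=
    (hasFDerivAt_id X).const_smul c
  have h3 := h1.comp X h2
  have h4 := ((hq.contDiffAt hX).differentiableAt (by simp)).hasFDerivAt.const_mul (c ^ 2)
  have h5 := h3.unique (h4.congr_of_eventuallyEq (.of_forall fun Y => hq.smul hc Y))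
  ext W
  have h6 := DFunLike.congr_fun h5 W
  simp only [ContinuousLinearMap.comp_apply, smul_apply, ContinuousLinearMap.id_apply, map_smul,
    smul_eq_mul] at h6 ⊢
  have := hc.ne'
  apply mul_left_cancel₀ this
  rw [h6]
  ring

/-- Euler's identity for the derivative, which is homogeneous of degree one. -/
theorem hess_self (hX : X ≠ 0) : hess q X X = fderiv ℝ q X := by
  have h1 : HasDerivAt (fun c : ℝ => fderiv ℝ q (c • X)) (hess q X X) 1 := by
    have h := (hq.contDiffAt_two hX).hasFDerivAt_fderiv
    rw [show X = (1 : ℝ) • X by simp] at h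
    have h2 : HasDerivAt (fun c : ℝ => c • X) X 1 := by
      simpa using (hasDerivAt_id (1 : ℝ)).smul_const X
    have h4 := h.comp_hasDerivAt (1 : ℝ) h2
    simp only [one_smul] at h4
    exact h4
  have h3 : HasDerivAt (fun c : ℝ => c • fderiv ℝ q X) (fderiv ℝ q X) 1 := by
    simpa using (hasDerivAt_id (1 : ℝ)).smul_const (fderiv ℝ q X)
  refine h1.unique (h3.congr_of_eventuallyEq ?_)
  filter_upwards [lt_mem_nhds (one_pos : (0 : ℝ) < 1)] with c hc using hq.fderiv_smul hc hX

theorem contDiffAt_radialMap (hX : X ≠ 0) : ContDiffAt ℝ ∞ (radialMap q) X :=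
  (((hq.contDiffAt hX).sqrt (hq.pos hX).ne').inv (Real.sqrt_pos.2 (hq.pos hX)).ne').smul
    contDiffAt_id

/-- The derivative of the radial map is a multiple of the identity up to a radial term. -/
theorem exists_fderiv_radialMap (hX : X ≠ 0) :
    ∃ c : ℝ, 0 < c ∧ ∀ W, ∃ l : ℝ, fderiv ℝ (radialMap q) X W = c • W + l • X ∧
      fderiv ℝ q X (fderiv ℝ (radialMap q) X W) = 0 := by
  have hs : 0 < √(q X) := Real.sqrt_pos.2 (hq.pos hX)
  have h1 := ((hq.contDiffAt hX).differentiableAt (by simp)).hasFDerivAt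
  have h3 := ((hasDerivAt_inv hs.ne').comp_hasFDerivAt X (h1.sqrt (hq.pos hX).ne')).smul
    (hasFDerivAt_id X)
  refine ⟨(√(q X))⁻¹, inv_pos.2 hs, fun W => ?_⟩
  have h4 : fderiv ℝ (radialMap q) X = _ := h3.fderiv
  have h5 := DFunLike.congr_fun h4 W
  refine ⟨-((√(q X) ^ 2)⁻¹ * (1 / (2 * √(q X)) * fderiv ℝ q X W)), ?_⟩
  have h6 : fderiv ℝ (radialMap q) X W = (√(q X))⁻¹ • W
      + (-((√(q X) ^ 2)⁻¹ * (1 / (2 * √(q X)) * fderiv ℝ q X W))) • X := by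
    rw [h5]
    simp
  refine ⟨h6, ?_⟩
  rw [h6, map_add, map_smul, map_smul, hq.fderiv_self hX, smul_eq_mul, smul_eq_mul]
  rw [Real.sq_sqrt (hq.pos hX).le]
  have := (hq.pos hX).ne'
  field_simp
  ring

end IsGauge

variable [CompleteSpace E]

/-- The Riesz isomorphism from the dual to the space, as a linear map. -/
noncomputable def rieszVec : (E →L[ℝ] ℝ) →L[ℝ] E :=
  LinearMap.mkContinuous
    { toFun := (InnerProductSpace.toDual ℝ E).symm
      map_add' := map_add _
      map_smul' := fun c l => by simp } 1 fun l => by simp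

@[simp] theorem inner_rieszVec (l : E →L[ℝ] ℝ) (W : E) : inner ℝ (rieszVec l) W = l W := by
  simp [rieszVec]

/-- The normalized gradient of `q`. -/
noncomputable def unitGrad (q : E → ℝ) (X : E) : E :=
  ‖rieszVec (fderiv ℝ q X)‖⁻¹ • rieszVec (fderiv ℝ q X)

namespace IsGauge

variable {q : E → ℝ} (hq : IsGauge q) {X : E}
include hq

theorem rieszVec_fderiv_ne_zero (hX : X ≠ 0) : rieszVec (fderiv ℝ q X) ≠ 0 := by
  intro h
  have h1 := inner_rieszVec (fderiv ℝ q X) X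
  rw [h, inner_zero_left, hq.fderiv_self hX] at h1
  have := hq.pos hX
  linarith

theorem contDiffAt_rieszVec_fderiv (hX : X ≠ 0) :
    ContDiffAt ℝ ∞ (fun Y => rieszVec (fderiv ℝ q Y)) X :=
  (rieszVec (E := E)).contDiff.contDiffAt.comp X ((hq.contDiffAt hX).fderiv_right (by simp))

theorem contDiffAt_unitGrad (hX : X ≠ 0) : ContDiffAt ℝ ∞ (unitGrad q) X :=
  (((hq.contDiffAt_rieszVec_fderiv hX).norm ℝ (hq.rieszVec_fderiv_ne_zero hX)).inv
    (norm_ne_zero_iff.2 (hq.rieszVec_fderiv_ne_zero hX))).smul (hq.contDiffAt_rieszVec_fderiv hX)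

theorem norm_unitGrad (hX : X ≠ 0) : ‖unitGrad q X‖ = 1 := by
  rw [unitGrad, norm_smul, norm_inv, norm_norm,
    inv_mul_cancel₀ (norm_ne_zero_iff.2 (hq.rieszVec_fderiv_ne_zero hX))]

/-- The derivative of the normalized gradient is a multiple of the second derivative of `q`, up to a
normal term. -/
theorem exists_fderiv_unitGrad (hX : X ≠ 0) :
    ∃ r : ℝ, 0 < r ∧ ∀ W Z, fderiv ℝ q X Z = 0 →
      inner ℝ (fderiv ℝ (unitGrad q) X W) Z = r * hess q X W Z := by
  have hn := hq.rieszVec_fderiv_ne_zero hX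
  have h1 : HasFDerivAt (fun Y => rieszVec (fderiv ℝ q Y))
      ((rieszVec (E := E)).comp (hess q X)) X :=
    (rieszVec (E := E)).hasFDerivAt.comp X (hq.contDiffAt_two hX).hasFDerivAt_fderiv
  have h2 : ContDiffAt ℝ ∞ (fun Y => ‖rieszVec (fderiv ℝ q Y)‖⁻¹) X :=
    ((hq.contDiffAt_rieszVec_fderiv hX).norm ℝ hn).inv (norm_ne_zero_iff.2 hn)
  have h3 := (h2.differentiableAt (by simp)).hasFDerivAt.smul h1
  refine ⟨‖rieszVec (fderiv ℝ q X)‖⁻¹, inv_pos.2 (norm_pos_iff.2 hn), fun W Z hZ => ?_⟩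
  have h4 : fderiv ℝ (unitGrad q) X = _ := h3.fderiv
  rw [h4]
  simp [inner_add_left, inner_smul_left, hZ]

/-- The second fundamental form of the level set, pulled back to the tangent space of the space of
directions, is a positive multiple of the second derivative of `q` on tangent vectors. -/
theorem exists_inner_unitGrad_radialMap (hX : X ≠ 0) :
    ∃ r : ℝ, 0 < r ∧ ∀ W Z, inner ℝ (fderiv ℝ (unitGrad q) X W) (fderiv ℝ (radialMap q) X Z) =
      r * hess q X (fderiv ℝ (radialMap q) X W) (fderiv ℝ (radialMap q) X Z) := by
  obtain ⟨c, hc, h1⟩ := hq.exists_fderiv_radialMap hX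
  obtain ⟨r, hr, h2⟩ := hq.exists_fderiv_unitGrad hX
  refine ⟨r / c, div_pos hr hc, fun W Z => ?_⟩
  obtain ⟨-, -, hZ⟩ := h1 Z
  obtain ⟨l, hW, -⟩ := h1 W
  rw [h2 _ _ hZ]
  rw [hW]
  rw [map_add, map_smul, map_smul, add_apply, smul_apply, smul_apply, hq.hess_self hX, hZ,
    smul_eq_mul, smul_zero, add_zero]
  have := hc.ne'
  field_simp

end IsGauge

end

/-! ### Operators with nonnegative quadratic form -/

/-- An operator whose quadratic form, for an inner product pulled back by an injective map `L`, is
nonnegative, has a nonnegative determinant: the segment from it to the identity consists of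
invertible operators, except for its end. -/
theorem LinearMap.det_nonneg_of_inner_nonneg {T E : Type*} [NormedAddCommGroup T]
    [NormedSpace ℝ T] [FiniteDimensional ℝ T] [NormedAddCommGroup E] [InnerProductSpace ℝ E]
    (L : T →ₗ[ℝ] E) (hL : Function.Injective L) (A : T →ₗ[ℝ] T)
    (hA : ∀ v, 0 ≤ inner ℝ (L (A v)) (L v)) : 0 ≤ LinearMap.det A := by
  by_contra! hneg
  let A' : T →L[ℝ] T := LinearMap.toContinuousLinearMap A
  let γ : ℝ → ℝ := fun s => ((1 - s) • A' + s • ContinuousLinearMap.id ℝ T).det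
  have hγ : Continuous γ := by
    have : Continuous fun s : ℝ => (1 - s) • A' + s • ContinuousLinearMap.id ℝ T := by fun_prop
    exact ContinuousLinearMap.continuous_det.comp this
  have h0 : γ 0 < 0 := by simpa [γ, ContinuousLinearMap.det, A'] using hneg
  have h1 : γ 1 = 1 := by simp [γ, ContinuousLinearMap.det]
  obtain ⟨s, hs, hs0⟩ := intermediate_value_Icc (zero_le_one' ℝ) hγ.continuousOn
    (show (0 : ℝ) ∈ Set.Icc (γ 0) (γ 1) from ⟨h0.le, by rw [h1]; exact zero_le_one⟩)
  have hspos : 0 < s := lt_of_le_of_ne hs.1 (by rintro rfl; exact h0.ne hs0)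
  have hker : LinearMap.ker
      ((((1 - s) • A' + s • ContinuousLinearMap.id ℝ T : T →L[ℝ] T)) : T →ₗ[ℝ] T) ≠ ⊥ :=
    fun h => by
      have := LinearMap.det_eq_zero_iff_ker_ne_bot.1 hs0
      exact this h
  obtain ⟨v, hv, hv0⟩ := Submodule.exists_mem_ne_zero_of_ne_bot hker
  have hv' : (1 - s) • A v + s • v = 0 := by simpa [A'] using hv
  have h2 : (1 - s) * inner ℝ (L (A v)) (L v) + s * inner ℝ (L v) (L v) = 0 := by
    have := congrArg (fun w => inner ℝ (L w) (L v)) hv'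
    simpa [inner_add_left, inner_smul_left] using this
  have h3 : 0 < inner ℝ (L v) (L v) := by
    rw [real_inner_self_eq_norm_sq]
    have : L v ≠ 0 := fun h => hv0 (hL (by rw [h, map_zero]))
    have := norm_pos_iff.2 this
    positivity
  have h4 : 0 ≤ (1 - s) * inner ℝ (L (A v)) (L v) := mul_nonneg (by linarith [hs.2]) (hA v)
  have h5 := mul_pos hspos h3
  linarith

/-! ### Curvature of a radial hypersurface -/

section

variable {n : ℕ}

-- the dimension fact about `ℝ^(n+1)` which the calculus of the sphere needs is an instance there
open scoped EuclideanSpace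

theorem contMDiff_comp_coe_sphere {f : Euc (n + 1) → Euc (n + 1)}
    (hf : ∀ X, X ≠ 0 → ContDiffAt ℝ ∞ f X) :
    ContMDiff (𝓡 n) 𝓘(ℝ, Euc (n + 1)) ∞ fun p : USphere (n + 1) => f p := fun p =>
  (hf p (ne_zero_of_mem_unit_sphere p)).contMDiffAt.comp p contMDiff_coe_sphere.contMDiffAt

/-- The differential of the inclusion of the sphere. -/
noncomputable def inclDiff (p : USphere (n + 1)) : TangentSpace (𝓡 n) p →ₗ[ℝ] Euc (n + 1) :=
  sphereDiff (fun p => (p : Euc (n + 1))) p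

theorem inclDiff_injective (p : USphere (n + 1)) : Function.Injective (inclDiff p) :=
  injective_mvfderiv_subtypeVal_sphere p

theorem range_inclDiff (p : USphere (n + 1)) :
    LinearMap.range (inclDiff p) = (ℝ ∙ (p : Euc (n + 1)))ᗮ :=
  range_mvfderiv_subtypeVal p

theorem sphereDiff_comp_coe {f : Euc (n + 1) → Euc (n + 1)} {p : USphere (n + 1)}
    (hf : ContDiffAt ℝ ∞ f p) (v : TangentSpace (𝓡 n) p) :
    sphereDiff (fun p => f p) p v = fderiv ℝ f p (inclDiff p v) := by
  have h1 : MDifferentiableAt 𝓘(ℝ, Euc (n + 1)) 𝓘(ℝ, Euc (n + 1)) f p :=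
    (hf.differentiableAt (by simp)).mdifferentiableAt
  have h2 : MDifferentiableAt (𝓡 n) 𝓘(ℝ, Euc (n + 1))
      (fun p : USphere (n + 1) => (p : Euc (n + 1))) p :=
    (contMDiff_coe_sphere (m := ∞)).contMDiffAt.mdifferentiableAt (by simp)
  have h3 := mfderiv_comp p h1 h2
  rw [mfderiv_eq_fderiv] at h3
  exact DFunLike.congr_fun h3 v

theorem gaussRank_add_finrank_ker (N : USphere (n + 1) → Euc (n + 1)) (p : USphere (n + 1)) :
    gaussRank N p + Module.finrank ℝ (LinearMap.ker (sphereDiff N p)) = n := by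
  have : Module.Finite ℝ (TangentSpace (𝓡 n) p) :=
    inferInstanceAs (Module.Finite ℝ (EuclideanSpace ℝ (Fin n)))
  refine (LinearMap.finrank_range_add_finrank_ker _).trans ?_
  exact finrank_euclideanSpace_fin

/-- The radial hypersurface of `q`. -/
noncomputable def gaugeImmersion (q : Euc (n + 1) → ℝ) (p : USphere (n + 1)) : Euc (n + 1) :=
  radialMap q p

/-- The Gauss map of the radial hypersurface of `q`. -/
noncomputable def gaugeNormal (q : Euc (n + 1) → ℝ) (p : USphere (n + 1)) : Euc (n + 1) :=
  unitGrad q p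

namespace IsGauge

variable {q : Euc (n + 1) → ℝ} (hq : IsGauge q) (p : USphere (n + 1))
include hq

theorem sphereDiff_immersion (v : TangentSpace (𝓡 n) p) :
    sphereDiff (gaugeImmersion q) p v = fderiv ℝ (radialMap q) p (inclDiff p v) :=
  sphereDiff_comp_coe (hq.contDiffAt_radialMap (ne_zero_of_mem_unit_sphere p)) v

theorem sphereDiff_normal (v : TangentSpace (𝓡 n) p) :
    sphereDiff (gaugeNormal q) p v = fderiv ℝ (unitGrad q) p (inclDiff p v) :=
  sphereDiff_comp_coe (hq.contDiffAt_unitGrad (ne_zero_of_mem_unit_sphere p)) v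

theorem isSmoothImmersion : IsSmoothImmersion (gaugeImmersion q) := by
  refine ⟨contMDiff_comp_coe_sphere fun X hX => hq.contDiffAt_radialMap hX, fun p => ?_⟩
  refine (injective_iff_map_eq_zero _).2 fun v hv => ?_
  obtain ⟨c, hc, h⟩ := hq.exists_fderiv_radialMap (ne_zero_of_mem_unit_sphere p)
  obtain ⟨l, hl, -⟩ := h (inclDiff p v)
  rw [hq.sphereDiff_immersion, hl] at hv
  have h1 : inner ℝ (p : Euc (n + 1)) (inclDiff p v) = 0 :=
    Submodule.mem_orthogonal_singleton_iff_inner_right.1 (range_inclDiff p ▸ ⟨v, rfl⟩)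
  have h2 := congrArg (fun w => inner ℝ w (inclDiff p v)) hv
  simp only [inner_add_left, inner_smul_left, h1, inner_zero_left] at h2
  have h3 : inclDiff p v = 0 := by simpa [hc.ne'] using h2
  exact inclDiff_injective p (by rw [h3, map_zero])

theorem isGaussMap : IsGaussMap (gaugeImmersion q) (gaugeNormal q) := by
  refine ⟨contMDiff_comp_coe_sphere fun X hX => hq.contDiffAt_unitGrad hX,
    fun p => hq.norm_unitGrad (ne_zero_of_mem_unit_sphere p), fun p v => ?_⟩
  obtain ⟨c, hc, h⟩ := hq.exists_fderiv_radialMap (ne_zero_of_mem_unit_sphere p)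
  obtain ⟨-, -, h0⟩ := h (inclDiff p v)
  rw [hq.sphereDiff_immersion, gaugeNormal, unitGrad, inner_smul_left, inner_rieszVec, h0, mul_zero]

theorem exists_inner_normal_immersion : ∃ r : ℝ, 0 < r ∧ ∀ v w : TangentSpace (𝓡 n) p,
    inner ℝ (sphereDiff (gaugeNormal q) p v) (sphereDiff (gaugeImmersion q) p w) =
      r * hess q p (sphereDiff (gaugeImmersion q) p v) (sphereDiff (gaugeImmersion q) p w) := by
  obtain ⟨r, hr, h⟩ := hq.exists_inner_unitGrad_radialMap (ne_zero_of_mem_unit_sphere p)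
  refine ⟨r, hr, fun v w => ?_⟩
  rw [hq.sphereDiff_immersion, hq.sphereDiff_immersion, hq.sphereDiff_normal]
  exact h _ _

/-- The shape operator is positive semidefinite for the metric induced by the immersion. -/
theorem gaussKronecker_nonneg (hpos : ∀ V, 0 ≤ hess q p V V) :
    0 ≤ gaussKronecker (gaugeImmersion q) (gaugeNormal q) p := by
  obtain ⟨r, hr, h⟩ := hq.exists_inner_normal_immersion p
  refine LinearMap.det_nonneg_of_inner_nonneg (T := EuclideanSpace ℝ (Fin n))
    (sphereDiff (gaugeImmersion q) p) (hq.isSmoothImmersion.2 p) _ fun v => ?_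
  have h1 := sphereDiff_shapeOperator hq.isSmoothImmersion hq.isGaussMap p v
  have h2 := h v v
  rw [← h1] at h2
  exact h2.symm ▸ mul_nonneg hr.le (hpos _)

theorem sphereDiff_normal_eq_zero_iff (hpos : ∀ V, 0 ≤ hess q p V V) (v : TangentSpace (𝓡 n) p) :
    sphereDiff (gaugeNormal q) p v = 0 ↔
      hess q p (sphereDiff (gaugeImmersion q) p v) (sphereDiff (gaugeImmersion q) p v) = 0 := by
  obtain ⟨r, hr, h⟩ := hq.exists_inner_normal_immersion p
  constructor
  · intro h0
    have := h v v
    rw [h0, inner_zero_left] at this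
    exact (mul_eq_zero.1 this.symm).resolve_left hr.ne'
  · intro h0
    have h1 := sphereDiff_shapeOperator hq.isSmoothImmersion hq.isGaussMap p v
    have h2 := h v (shapeOperator (gaugeImmersion q) (gaugeNormal q) p v)
    rw [hess_apply_eq_zero (hq.contDiffAt_two (ne_zero_of_mem_unit_sphere p)) hpos h0, h1,
      mul_zero] at h2
    exact inner_self_eq_zero.1 h2

theorem gaussKronecker_eq_zero_iff :
    gaussKronecker (gaugeImmersion q) (gaugeNormal q) p = 0 ↔
      ∃ v, v ≠ 0 ∧ sphereDiff (gaugeNormal q) p v = 0 := by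
  have : Module.Finite ℝ (TangentSpace (𝓡 n) p) :=
    inferInstanceAs (Module.Finite ℝ (EuclideanSpace ℝ (Fin n)))
  have hA := sphereDiff_shapeOperator hq.isSmoothImmersion hq.isGaussMap p
  rw [gaussKronecker, LinearMap.det_eq_zero_iff_ker_ne_bot, Submodule.ne_bot_iff]
  refine exists_congr fun v => ?_
  rw [and_comm, ← hA, LinearMap.mem_ker,
    map_eq_zero_iff _ (hq.isSmoothImmersion.2 p)]

/-- If the second derivative of `q` degenerates in a direction `e`, this direction is tangent to
the hypersurface, because `D²q(e, p) = Dq(e)`. -/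
theorem exists_sphereDiff_eq (hpos : ∀ V, 0 ≤ hess q p V V) {e : Euc (n + 1)}
    (he : hess q p e e = 0) :
    ∃ (c : ℝ) (v : TangentSpace (𝓡 n) p), c ≠ 0 ∧
      sphereDiff (gaugeImmersion q) p v = c • e := by
  have hp := ne_zero_of_mem_unit_sphere p
  have h1 : fderiv ℝ q p e = 0 := by
    rw [← hq.hess_self hp, hess_comm (hq.contDiffAt_two hp),
      hess_apply_eq_zero (hq.contDiffAt_two hp) hpos he]
  obtain ⟨c, hc, h⟩ := hq.exists_fderiv_radialMap hp
  have h2 : e - inner ℝ (p : Euc (n + 1)) e • (p : Euc (n + 1)) ∈ LinearMap.range (inclDiff p) := by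
    rw [range_inclDiff, Submodule.mem_orthogonal_singleton_iff_inner_right, inner_sub_right,
      inner_smul_right, real_inner_self_eq_norm_sq, norm_eq_of_mem_sphere]
    ring
  obtain ⟨v, hv⟩ := h2
  obtain ⟨l, hl, h0⟩ := h (inclDiff p v)
  refine ⟨c, v, hc.ne', ?_⟩
  have h3 : sphereDiff (gaugeImmersion q) p v =
      c • e + (l - c * inner ℝ (p : Euc (n + 1)) e) • (p : Euc (n + 1)) := by
    rw [hq.sphereDiff_immersion, hl, hv]
    module
  rw [← hq.sphereDiff_immersion, h3, map_add, map_smul, map_smul, h1, hq.fderiv_self hp,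
    smul_zero, zero_add, smul_eq_mul, mul_eq_zero] at h0
  have h4 := h0.resolve_right (by have := hq.pos hp; positivity)
  rw [h3, h4, zero_smul, add_zero]

/-- If the second derivative of `q` degenerates at most in one direction, the Gauss map has rank at
least `n - 1`. -/
theorem le_gaussRank (hpos : ∀ V, 0 ≤ hess q p V V) {e : Euc (n + 1)}
    (he : ∀ V, hess q p V V = 0 → ∃ t : ℝ, V = t • e) : n - 1 ≤ gaussRank (gaugeNormal q) p := by
  have h1 := gaussRank_add_finrank_ker (gaugeNormal q) p
  let K := LinearMap.ker (sphereDiff (gaugeNormal q) p)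
  have h2 : Module.finrank ℝ K ≤ 1 := by
    refine (Submodule.equivMapOfInjective _ (hq.isSmoothImmersion.2 p) K).finrank_eq.trans_le ?_
    refine (Submodule.finrank_mono (t := ℝ ∙ e) ?_).trans ?_
    · rintro _ ⟨v, hv, rfl⟩
      obtain ⟨t, ht⟩ := he _ ((hq.sphereDiff_normal_eq_zero_iff p hpos v).1 hv)
      exact Submodule.mem_span_singleton.2 ⟨t, ht.symm⟩
    · simpa using finrank_span_le_card (R := ℝ) ({e} : Set (Euc (n + 1)))
  change Module.finrank ℝ (LinearMap.ker (sphereDiff (gaugeNormal q) p)) ≤ 1 at h2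
  omega

theorem gaussRank_le
    (h0 : gaussKronecker (gaugeImmersion q) (gaugeNormal q) p = 0) :
    gaussRank (gaugeNormal q) p ≤ n - 1 := by
  have : Module.Finite ℝ (TangentSpace (𝓡 n) p) :=
    inferInstanceAs (Module.Finite ℝ (EuclideanSpace ℝ (Fin n)))
  obtain ⟨v, hv, hv0⟩ := (hq.gaussKronecker_eq_zero_iff p).1 h0
  have h1 := gaussRank_add_finrank_ker (gaugeNormal q) p
  have h2 : 0 < Module.finrank ℝ (LinearMap.ker (sphereDiff (gaugeNormal q) p)) := by
    refine Module.finrank_pos_iff_exists_ne_zero.2 ⟨⟨v, hv0⟩, fun h => hv ?_⟩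
    exact congrArg Subtype.val h
  omega

end IsGauge

end

/-! ### Good Cantor sets -/

theorem isOpen_geodesicBall {m : ℕ} (c : USphere m) (r : ℝ) : IsOpen (geodesicBall c r) := by
  have h : Continuous fun y : USphere m => InnerProductGeometry.angle (c : Euc m) (y : Euc m) := by
    refine continuous_iff_continuousAt.2 fun y => ?_
    have h1 := InnerProductGeometry.continuousAt_angle (x := ((c : Euc m), (y : Euc m)))
      (ne_zero_of_mem_unit_sphere c) (ne_zero_of_mem_unit_sphere y)
    exact h1.comp (f := fun y : USphere m => ((c : Euc m), (y : Euc m))) (by fun_prop)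
  exact isOpen_Iio.preimage h

/-- By connectedness the sphere of dimension at least one is not a disjoint union of small balls. -/
theorem IsGoodCantorSet.nonempty {m : ℕ} (hm : 2 ≤ m) {δ : ℝ} (hδ : δ ≤ Real.pi)
    {F : Set (USphere m)} (hF : IsGoodCantorSet δ F) : F.Nonempty := by
  by_contra hne
  rw [Set.not_nonempty_iff_eq_empty] at hne
  obtain ⟨-, U, -, hU, hd, hc⟩ := hF
  rw [hne, Set.compl_empty] at hc
  have hconn : IsConnected (Metric.sphere (0 : Euc m) 1) := by
    refine isConnected_sphere ?_ 0 zero_le_one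
    rw [← Module.finrank_eq_rank, finrank_euclideanSpace_fin]
    exact_mod_cast hm
  have : ConnectedSpace (USphere m) := isConnected_iff_connectedSpace.1 hconn
  have hopen : ∀ B ∈ U, IsOpen B := fun B hB => by
    obtain ⟨c, r, -, -, rfl⟩ := hU B hB
    exact isOpen_geodesicBall c r
  obtain ⟨y⟩ : Nonempty (USphere m) := inferInstance
  obtain ⟨B, hB, hyB⟩ : y ∈ ⋃₀ U := hc ▸ Set.mem_univ y
  have hcompl : Bᶜ = ⋃₀ (U \ {B}) := by
    ext z
    constructor
    · intro hz
      obtain ⟨B', hB', hzB'⟩ : z ∈ ⋃₀ U := hc ▸ Set.mem_univ z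
      exact ⟨B', ⟨hB', by rintro rfl; exact hz hzB'⟩, hzB'⟩
    · rintro ⟨B', ⟨hB', hne'⟩, hz⟩ hzB
      exact Set.disjoint_left.1 (hd hB' hB hne') hz hzB
  have hclopen : IsClopen B :=
    ⟨⟨hcompl ▸ isOpen_sUnion fun B' hB' => hopen B' hB'.1⟩, hopen B hB⟩
  have huniv := hclopen.eq_univ ⟨y, hyB⟩
  obtain ⟨c, r, -, hr, rfl⟩ := hU B hB
  -- the antipode of the centre is at distance `π`
  have h1 : -c ∈ geodesicBall c r := huniv ▸ Set.mem_univ _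
  have h2 : InnerProductGeometry.angle (c : Euc m) (-c : Euc m) < r := h1
  rw [InnerProductGeometry.angle_self_neg_of_nonzero (ne_zero_of_mem_unit_sphere c)] at h2
  linarith

theorem mem_prodDisk_iff {n : ℕ} {F : Set (USphere n)} {p : USphere (n + 1)} :
    p ∈ prodDisk F √(2 / 3) ↔ height (p : Euc (n + 1)) ^ 2 ≤ 2 * ‖base (p : Euc (n + 1))‖ ^ 2 ∧
      ∃ y ∈ F, (y : Euc n) = ‖base (p : Euc (n + 1))‖⁻¹ • base (p : Euc (n + 1)) := by
  have hns := norm_sq_eq_base_add_height (p : Euc (n + 1))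
  rw [norm_eq_of_mem_sphere, one_pow] at hns
  constructor
  · rintro ⟨y, hy, t, ht, h1, h2⟩
    have hb : base (p : Euc (n + 1)) = √(1 - t ^ 2) • (y : Euc n) := by
      ext i
      exact h1 i
    have ht2 : t ^ 2 ≤ 2 / 3 := by
      rw [← Real.sq_sqrt (show (0 : ℝ) ≤ 2 / 3 by norm_num)]
      exact sq_le_sq.2 ((abs_le.2 ⟨ht.1, ht.2⟩).trans (le_abs_self _))
    have hpos : 0 < √(1 - t ^ 2) := Real.sqrt_pos.2 (by linarith)
    have hn : ‖base (p : Euc (n + 1))‖ = √(1 - t ^ 2) := by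
      rw [hb, norm_smul, norm_eq_of_mem_sphere, mul_one, Real.norm_of_nonneg hpos.le]
    have hh : height (p : Euc (n + 1)) = t := h2
    refine ⟨?_, y, hy, ?_⟩
    · rw [hh, hn, Real.sq_sqrt (by linarith)]
      linarith
    · rw [hn, hb, inv_smul_smul₀ hpos.ne']
  · rintro ⟨h1, y, hy, hyp⟩
    have hn : √(1 - height (p : Euc (n + 1)) ^ 2) = ‖base (p : Euc (n + 1))‖ := by
      rw [show 1 - height (p : Euc (n + 1)) ^ 2 = ‖base (p : Euc (n + 1))‖ ^ 2 by linarith,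
        Real.sqrt_sq (norm_nonneg _)]
    refine ⟨y, hy, height (p : Euc (n + 1)), abs_le.1 (Real.abs_le_sqrt (by linarith)), fun i => ?_,
      rfl⟩
    have hb : ‖base (p : Euc (n + 1))‖ ≠ 0 := by
      intro h0
      rw [h0] at h1 hns
      linarith
    have h2 : base (p : Euc (n + 1)) = ‖base (p : Euc (n + 1))‖ • (y : Euc n) := by
      rw [hyp, smul_inv_smul₀ hb]
    rw [hn]
    exact congrArg (fun z : Euc n => z i) h2

theorem exists_mem_prodDisk {n : ℕ} {F : Set (USphere n)} (hF : F.Nonempty) {a : ℝ} (ha : 0 ≤ a) :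
    ∃ p : USphere (n + 1), p ∈ prodDisk F a := by
  obtain ⟨y, hy⟩ := hF
  have h : ‖(WithLp.toLp 2 (Fin.snoc (y : Euc n) 0 : Fin (n + 1) → ℝ) : Euc (n + 1))‖ ^ 2 = 1 := by
    rw [EuclideanSpace.norm_sq_eq, Fin.sum_univ_castSucc]
    have := EuclideanSpace.norm_sq_eq (y : Euc n)
    rw [norm_eq_of_mem_sphere, one_pow] at this
    simpa using this.symm
  refine ⟨⟨WithLp.toLp 2 (Fin.snoc (y : Euc n) 0), ?_⟩, y, hy, 0, ⟨by linarith, ha⟩, ?_, ?_⟩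
  · rw [mem_sphere_zero_iff_norm]
    exact (pow_eq_one_iff_of_nonneg (norm_nonneg _) two_ne_zero).1 h
  · simp
  · simp

theorem theoremA (n : ℕ) (hn : 1 ≤ n) :
    ∃ δ₀ : ℝ, 0 < δ₀ ∧
      ∀ F : Set (USphere n), IsGoodCantorSet δ₀ F → (n = 1 → F.Nonempty) →
        ∃ x N : USphere (n + 1) → Euc (n + 1),
          IsSmoothImmersion x ∧ IsGaussMap x N ∧
          IsLeast (Set.range (gaussRank N)) (n - 1) ∧
          (∀ p, 0 ≤ gaussKronecker x N p) ∧
          ∃ a : ℝ, 0 < a ∧ a < 1 ∧ {p | gaussKronecker x N p = 0} = prodDisk F a := by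
  refine ⟨Real.pi, Real.pi_pos, fun F hF hF1 => ?_⟩
  have hne : F.Nonempty := by
    rcases hn.eq_or_lt with h | h
    · exact hF1 h.symm
    · exact hF.nonempty h le_rfl
  have hcl : IsClosed ((fun y : USphere n => (y : Euc n)) '' F) :=
    (hF.1.image continuous_subtype_val).isClosed
  obtain ⟨φ, hsupp, hφ, hrange⟩ := hcl.isOpen_compl.exists_contDiff_support_eq (n := ⊤)
  have hφ1 : ∀ z, |φ z| ≤ 1 := fun z => by
    have := hrange (Set.mem_range_self z)
    rw [abs_of_nonneg this.1]
    exact this.2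
  have hzero : ∀ z, φ z = 0 ↔ ∃ y ∈ F, (y : Euc n) = z := fun z => by
    rw [← Function.notMem_support, hsupp, Set.notMem_compl_iff]
    rfl
  have hR : ∀ z, radialExt φ z = 0 ↔ ∃ y ∈ F, (y : Euc n) = ‖z‖⁻¹ • z := fun z => hzero _
  obtain ⟨ε, hε, hH⟩ := exists_hess_capGauge_bound hφ hφ1
  have hq : IsGauge (capGauge φ ε) :=
    ⟨contDiffAt_capGauge hφ ε, capGauge_smul φ ε, capGauge_pos φ hε.le⟩
  have hpos : ∀ (p : USphere (n + 1)) V, 0 ≤ hess (capGauge φ ε) p V V := fun p V => by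
    obtain ⟨μ, hμ, -, h, -⟩ := hH p (norm_eq_of_mem_sphere p)
    exact (by positivity : 0 ≤ ‖base V‖ ^ 2 + μ * height V ^ 2).trans (h V)
  have hset : ∀ p, gaussKronecker (gaugeImmersion (capGauge φ ε)) (gaugeNormal (capGauge φ ε)) p = 0
      ↔ p ∈ prodDisk F √(2 / 3) := fun p => by
    obtain ⟨μ, hμ, hμ0, h, haxis⟩ := hH p (norm_eq_of_mem_sphere p)
    rw [mem_prodDisk_iff, ← hR, ← hμ0, hq.gaussKronecker_eq_zero_iff]
    constructor
    · rintro ⟨v, hv, hv0⟩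
      have h1 := h (sphereDiff (gaugeImmersion (capGauge φ ε)) p v)
      rw [(hq.sphereDiff_normal_eq_zero_iff p (hpos p) v).1 hv0] at h1
      by_contra hne0
      have hμpos : 0 < μ := lt_of_le_of_ne hμ (Ne.symm hne0)
      have h2 : 0 ≤ μ * height (sphereDiff (gaugeImmersion (capGauge φ ε)) p v) ^ 2 := by positivity
      have h3 : ‖base (sphereDiff (gaugeImmersion (capGauge φ ε)) p v)‖ ^ 2 = 0 :=
        le_antisymm (by linarith) (sq_nonneg _)
      have h4 : height (sphereDiff (gaugeImmersion (capGauge φ ε)) p v) = 0 := by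
        have : μ * height (sphereDiff (gaugeImmersion (capGauge φ ε)) p v) ^ 2 = 0 := by linarith
        simpa [hμpos.ne'] using this
      have h5 := eq_smul_axis (norm_eq_zero.1 (pow_eq_zero_iff two_ne_zero |>.1 h3))
      rw [h4, zero_smul] at h5
      exact hv (hq.isSmoothImmersion.2 p (by rw [h5, map_zero]))
    · intro h0
      obtain ⟨c, v, hc, hv⟩ := hq.exists_sphereDiff_eq p (hpos p) (haxis h0)
      refine ⟨v, ?_, (hq.sphereDiff_normal_eq_zero_iff p (hpos p) v).2 ?_⟩
      · rintro rfl
        have h1 := congrArg height hv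
        simp only [map_zero, map_smul, height_axis, smul_eq_mul, mul_one] at h1
        exact hc h1.symm
      · rw [hv]
        simp [haxis h0]
  have hrank : ∀ p, n - 1 ≤ gaussRank (gaugeNormal (capGauge φ ε)) p := fun p => by
    obtain ⟨μ, hμ, -, h, -⟩ := hH p (norm_eq_of_mem_sphere p)
    refine hq.le_gaussRank p (hpos p) (e := axis) fun V hV => ⟨height V, eq_smul_axis ?_⟩
    have h1 := h V
    have h2 : 0 ≤ μ * height V ^ 2 := by positivity
    have h3 : ‖base V‖ ^ 2 = 0 := le_antisymm (by linarith) (sq_nonneg _)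
    simpa using h3
  have ha : (0 : ℝ) < √(2 / 3) := by positivity
  refine ⟨gaugeImmersion (capGauge φ ε), gaugeNormal (capGauge φ ε), hq.isSmoothImmersion,
    hq.isGaussMap, ⟨?_, ?_⟩, fun p => hq.gaussKronecker_nonneg p (hpos p), √(2 / 3), ha, ?_,
    Set.ext hset⟩
  · obtain ⟨p, hp⟩ := exists_mem_prodDisk hne ha.le
    refine ⟨p, le_antisymm (hq.gaussRank_le p ((hset p).2 hp)) (hrank p)⟩
  · rintro _ ⟨p, rfl⟩
    exact hrank p
  · rw [Real.sqrt_lt' one_pos]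
    norm_num
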